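/- Let $\mathcal H$ be a finite-dimensional complex Hilbert space of dimension $d$, and let $\mathcal P(\mathcal H)\cong\mathbb{CP}^{d-1}$ be its projective space, the set of complex lines $[\psi]$ spanned by nonzero vectors $\psi\in\mathcal H$, with its usual structure of a smooth manifold. The Fubini--Study metric $g_{\mathrm{FS}}$ is the Riemannian metric on $\mathcal P(\mathcal H)$ such that, for every unit vector $\psi\in\mathcal H$ and all $\xi,\eta\in\mathcal H$, \[ g_{\mathrm{FS},[\psi]}\big(d\pi_\psi\xi,\,d\pi_\psi\eta\big)=\operatorname{Re}\big(\langle\xi,\eta\rangle-\langle\xi,\psi\rangle\langle\psi,\eta\rangle\big), \] where $\pi:\mathcal H\setminus\{0\}\to\mathcal P(\mathcal H)$, $\pi(\psi)=[\psi]$, and the inner product is linear in its second argument. Then $g_{\mathrm{FS}}$ is invariant under the unitary group of $\mathcal H$, which acts by $U[\psi]=[U\psi]$; and every smooth Riemannian metric $g$ on $\mathcal P(\mathcal H)$ that is invariant under the unitary group is of the form $g=c\,g_{\mathrm{FS}}$ for some constant $c>0$. -/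

import Mathlib

open scoped LinearAlgebra.Projectivization Manifold ContDiff InnerProductSpace Topology
open Module

noncomputable section

namespace ProjectiveHilbert

variable (H : Type*) [NormedAddCommGroup H] [InnerProductSpace ℂ H]

/-- The space `ℂ^(d-1)`, `d = dim H`, on which the projective space of `H` is modelled. -/
abbrev Model : Type := EuclideanSpace ℂ (Fin (finrank ℂ H - 1))

variable {H}

/-- The quotient topology of `H ∖ {0}`. -/
instance : TopologicalSpace (ℙ ℂ H) :=
  TopologicalSpace.coinduced (Projectivization.mk' ℂ) inferInstance

theorem isQuotientMap_mk' :
    Topology.IsQuotientMap (Projectivization.mk' ℂ : {v : H // v ≠ 0} → ℙ ℂ H) :=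
  ⟨⟨rfl⟩, Quotient.mk''_surjective⟩

/-- A unit vector on the line `p`. -/
def unitRep (p : ℙ ℂ H) : H := ((‖p.rep‖ : ℂ)⁻¹) • p.rep

theorem norm_unitRep (p : ℙ ℂ H) : ‖unitRep p‖ = 1 := by
  have := norm_ne_zero_iff.2 p.rep_nonzero
  simp [unitRep, norm_smul, this]

theorem unitRep_ne_zero (p : ℙ ℂ H) : unitRep p ≠ 0 :=
  norm_ne_zero_iff.1 (by simp [norm_unitRep])

theorem mk_unitRep (p : ℙ ℂ H) : Projectivization.mk ℂ (unitRep p) (unitRep_ne_zero p) = p := by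
  conv_rhs => rw [← p.mk_rep]
  exact (Projectivization.mk_eq_mk_iff' ℂ _ _ _ _).2 ⟨_, rfl⟩

theorem inner_unitRep_self (p : ℙ ℂ H) : ⟪unitRep p, unitRep p⟫_ℂ = 1 := by
  simp [inner_self_eq_norm_sq_to_K, norm_unitRep]

theorem inner_rep_mk_ne_zero_iff (p : ℙ ℂ H) (χ : H) (hχ : χ ≠ 0) :
    ⟪unitRep p, (Projectivization.mk ℂ χ hχ).rep⟫_ℂ ≠ 0 ↔ ⟪unitRep p, χ⟫_ℂ ≠ 0 := by
  obtain ⟨a, ha⟩ := Projectivization.exists_smul_eq_mk_rep ℂ χ hχ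
  rw [← ha, Units.smul_def, inner_smul_right]
  simp

theorem isOpen_source (p : ℙ ℂ H) : IsOpen {q : ℙ ℂ H | ⟪unitRep p, q.rep⟫_ℂ ≠ 0} := by
  rw [← isQuotientMap_mk'.isOpen_preimage]
  have : (Projectivization.mk' ℂ ⁻¹' {q : ℙ ℂ H | ⟪unitRep p, q.rep⟫_ℂ ≠ 0}) =
      {v : {v : H // v ≠ 0} | ⟪unitRep p, v.1⟫_ℂ ≠ 0} := by
    ext v
    exact inner_rep_mk_ne_zero_iff p v.1 v.2
  rw [this]
  exact isOpen_ne_fun (by fun_prop) continuous_const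

/-- The Fubini-Study form `Re (⟨ξ, η⟩ - ⟨ξ, ψ⟩⟨ψ, η⟩)` at a unit vector `ψ`: the real bilinear form
with quadratic form `⟨ξ, ξ⟩ - |⟨ψ, ξ⟩|²`. -/
def fsForm (ψ ξ η : H) : ℝ := (⟪ξ, η⟫_ℂ - ⟪ξ, ψ⟫_ℂ * ⟪ψ, η⟫_ℂ).re

variable [FiniteDimensional ℂ H]

theorem finrank_orthogonal_unitRep (p : ℙ ℂ H) :
    finrank ℂ (ℂ ∙ unitRep p)ᗮ = finrank ℂ H - 1 := by
  have h := Submodule.finrank_add_finrank_orthogonal (ℂ ∙ unitRep p)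
  rw [finrank_span_singleton (unitRep_ne_zero p)] at h
  omega

/-- A linear isometry from the model space onto the orthogonal complement of the line `p`. -/
def lift (p : ℙ ℂ H) : Model H →L[ℂ] H :=
  (ℂ ∙ unitRep p)ᗮ.subtypeL ∘L
    (((stdOrthonormalBasis ℂ (ℂ ∙ unitRep p)ᗮ).reindex
      (finCongr (finrank_orthogonal_unitRep p))).repr.symm : Model H →L[ℂ] (ℂ ∙ unitRep p)ᗮ)

/-- The adjoint of `lift p`. -/
def colift (p : ℙ ℂ H) : H →L[ℂ] Model H := ContinuousLinearMap.adjoint (lift p)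

theorem inner_unitRep_lift (p : ℙ ℂ H) (z : Model H) : ⟪unitRep p, lift p z⟫_ℂ = 0 :=
  Submodule.mem_orthogonal_singleton_iff_inner_right.1 (Subtype.property _)

theorem inner_lift_lift (p : ℙ ℂ H) (z w : Model H) : ⟪lift p z, lift p w⟫_ℂ = ⟪z, w⟫_ℂ := by
  change ⟪(_ : (ℂ ∙ unitRep p)ᗮ), _⟫_ℂ = _
  exact LinearIsometryEquiv.inner_map_map _ z w

theorem colift_lift (p : ℙ ℂ H) (z : Model H) : colift p (lift p z) = z :=
  ext_inner_left ℂ fun w => by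
    rw [colift, ContinuousLinearMap.adjoint_inner_right, inner_lift_lift]

theorem colift_unitRep (p : ℙ ℂ H) : colift p (unitRep p) = 0 :=
  ext_inner_left ℂ fun w => by
    rw [colift, ContinuousLinearMap.adjoint_inner_right, inner_zero_right, ← inner_conj_symm,
      inner_unitRep_lift, map_zero]

theorem decomp (p : ℙ ℂ H) (χ : H) :
    ⟪unitRep p, χ⟫_ℂ • unitRep p + lift p (colift p χ) = χ := by
  have h : χ - ⟪unitRep p, χ⟫_ℂ • unitRep p ∈ (ℂ ∙ unitRep p)ᗮ := by
    rw [Submodule.mem_orthogonal_singleton_iff_inner_right, inner_sub_right, inner_smul_right,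
      inner_unitRep_self, mul_one, sub_self]
  obtain ⟨z, hz⟩ : ∃ z, lift p z = χ - ⟪unitRep p, χ⟫_ℂ • unitRep p := by
    refine ⟨((stdOrthonormalBasis ℂ (ℂ ∙ unitRep p)ᗮ).reindex
      (finCongr (finrank_orthogonal_unitRep p))).repr ⟨_, h⟩, ?_⟩
    simp [lift]
  have h2 : colift p χ = z := by
    rw [← colift_lift p z, hz, map_sub, map_smul, colift_unitRep, smul_zero, sub_zero]
  rw [h2, hz, add_sub_cancel]

/-- The affine coordinate `ψ ↦ ⟨p, ψ⟩⁻¹ • (orthogonal projection of ψ to p^⊥)`. -/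
def coord (p : ℙ ℂ H) (χ : H) : Model H := (⟪unitRep p, χ⟫_ℂ)⁻¹ • colift p χ

theorem coord_smul (p : ℙ ℂ H) {a : ℂ} (ha : a ≠ 0) (χ : H) : coord p (a • χ) = coord p χ := by
  simp only [coord, inner_smul_right, map_smul, smul_smul, mul_inv]
  congr 1
  field_simp

theorem coord_rep_mk (p : ℙ ℂ H) (χ : H) (hχ : χ ≠ 0) :
    coord p (Projectivization.mk ℂ χ hχ).rep = coord p χ := by
  obtain ⟨a, ha⟩ := Projectivization.exists_smul_eq_mk_rep ℂ χ hχ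
  rw [← ha, Units.smul_def, coord_smul p a.ne_zero]

theorem inner_unitRep_affine (p : ℙ ℂ H) (z : Model H) :
    ⟪unitRep p, unitRep p + lift p z⟫_ℂ = 1 := by
  rw [inner_add_right, inner_unitRep_lift, inner_unitRep_self, add_zero]

theorem affine_ne_zero (p : ℙ ℂ H) (z : Model H) : unitRep p + lift p z ≠ 0 := fun h => by
  simpa [h] using inner_unitRep_affine p z

theorem coord_affine (p : ℙ ℂ H) (z : Model H) : coord p (unitRep p + lift p z) = z := by
  rw [coord, inner_unitRep_affine, inv_one, one_smul, map_add, colift_unitRep, colift_lift, zero_add]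

theorem affine_coord (p : ℙ ℂ H) (χ : H) (h : ⟪unitRep p, χ⟫_ℂ ≠ 0) :
    ⟪unitRep p, χ⟫_ℂ • (unitRep p + lift p (coord p χ)) = χ := by
  rw [coord, map_smul, smul_add, smul_smul, mul_inv_cancel₀ h, one_smul, decomp]

theorem contDiffAt_coord (p : ℙ ℂ H) (χ : H) (h : ⟪unitRep p, χ⟫_ℂ ≠ 0) :
    ContDiffAt ℝ ∞ (coord p) χ := by
  have h1 : ContDiffAt ℂ ∞ (coord p) χ := by
    unfold coord
    exact ((innerSL ℂ (unitRep p)).contDiff.contDiffAt.inv h).smul (colift p).contDiff.contDiffAt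
  exact h1.restrict_scalars ℝ

/-- The affine chart centred at `p`: its inverse is `z ↦ [ψ + z]` with `ψ` a unit vector on the
line `p` and `z` in the orthogonal complement of `p`. -/
def affineChart (p : ℙ ℂ H) : OpenPartialHomeomorph (ℙ ℂ H) (Model H) where
  toFun q := coord p q.rep
  invFun z := Projectivization.mk ℂ (unitRep p + lift p z) (affine_ne_zero p z)
  source := {q | ⟪unitRep p, q.rep⟫_ℂ ≠ 0}
  target := Set.univ
  map_source' _ _ := Set.mem_univ _
  map_target' z _ := by
    rw [Set.mem_ofPred_eq, inner_rep_mk_ne_zero_iff, inner_unitRep_affine]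
    exact one_ne_zero
  left_inv' q hq := by
    conv_rhs => rw [← q.mk_rep]
    exact ((Projectivization.mk_eq_mk_iff' ℂ _ _ _ _).2 ⟨_, affine_coord p q.rep hq⟩).symm
  right_inv' z _ := by rw [coord_rep_mk, coord_affine]
  open_source := isOpen_source p
  open_target := isOpen_univ
  continuousOn_toFun := by
    rw [isQuotientMap_mk'.continuousOn_isOpen_iff (isOpen_source p)]
    intro v hv
    have hv' : ⟪unitRep p, v.1⟫_ℂ ≠ 0 := (inner_rep_mk_ne_zero_iff p v.1 v.2).1 hv
    have h1 : (fun q : ℙ ℂ H => coord p q.rep) ∘ Projectivization.mk' ℂ =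
        fun v : {v : H // v ≠ 0} => coord p v.1 := by
      ext1 v
      exact coord_rep_mk p v.1 v.2
    rw [h1]
    exact (ContinuousAt.comp (f := Subtype.val) (contDiffAt_coord p v.1 hv').continuousAt
      continuous_subtype_val.continuousAt).continuousWithinAt
  continuousOn_invFun := by
    refine Continuous.continuousOn ?_
    exact isQuotientMap_mk'.continuous.comp
      (Continuous.subtype_mk (f := fun z => unitRep p + lift p z) (by fun_prop) (affine_ne_zero p))

instance : ChartedSpace (Model H) (ℙ ℂ H) where
  atlas := Set.range affineChart
  chartAt := affineChart
  mem_chart_source p := by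
    change ⟪unitRep p, p.rep⟫_ℂ ≠ 0
    have h := (inner_rep_mk_ne_zero_iff p (unitRep p) (unitRep_ne_zero p)).2
      (by rw [inner_unitRep_self]; exact one_ne_zero)
    rwa [mk_unitRep] at h
  chart_mem_atlas p := ⟨p, rfl⟩

instance : IsManifold 𝓘(ℝ, Model H) ∞ (ℙ ℂ H) := by
  apply isManifold_of_contDiffOn
  rintro _ _ ⟨p, rfl⟩ ⟨q, rfl⟩ z ⟨⟨-, hz⟩, -⟩
  have hz' : ⟪unitRep q, unitRep p + lift p z⟫_ℂ ≠ 0 :=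
    (inner_rep_mk_ne_zero_iff q _ (affine_ne_zero p z)).1 hz
  refine ContDiffAt.contDiffWithinAt ?_
  have h1 : (𝓘(ℝ, Model H) ∘ (affineChart p).symm ≫ₕ affineChart q ∘ 𝓘(ℝ, Model H).symm) =
      coord q ∘ fun z => unitRep p + lift p z := by
    ext1 w
    exact coord_rep_mk q _ (affine_ne_zero p w)
  rw [h1]
  refine ContDiffAt.comp z (contDiffAt_coord q _ hz') ?_
  exact (contDiff_const.add ((lift p).restrictScalars ℝ).contDiff).contDiffAt


theorem fsForm_lift (p : ℙ ℂ H) (u v : Model H) :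
    fsForm (unitRep p) (lift p u) (lift p v) = (⟪u, v⟫_ℂ).re := by
  rw [fsForm, inner_unitRep_lift, mul_zero, sub_zero, inner_lift_lift]

theorem fsForm_colift (p : ℙ ℂ H) (ξ η : H) :
    (⟪colift p ξ, colift p η⟫_ℂ).re = fsForm (unitRep p) ξ η := by
  rw [← fsForm_lift p]
  have h1 : lift p (colift p ξ) = ξ - ⟪unitRep p, ξ⟫_ℂ • unitRep p :=
    eq_sub_of_add_eq' (decomp p ξ)
  have h2 : lift p (colift p η) = η - ⟪unitRep p, η⟫_ℂ • unitRep p :=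
    eq_sub_of_add_eq' (decomp p η)
  simp only [fsForm, inner_unitRep_lift, mul_zero, sub_zero]
  rw [h1, h2]
  simp only [inner_sub_left, inner_sub_right, inner_smul_left, inner_smul_right,
    inner_unitRep_self, inner_conj_symm]
  congr 1
  ring

/-- The Fubini-Study tensor at `p`. The tangent space at `p` is read in the affine chart centred at
`p`, in which `u` is the tangent vector at `t = 0` of the curve `t ↦ [ψ + t • lift p u]`, with `ψ` a
unit vector on the line `p`; so `lift p u`, which is orthogonal to `ψ`, is the horizontal lift of
`u`. See `fubiniStudy_mfderiv_proj` for the description at any unit vector on the line. -/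
def fsTensor (p : ℙ ℂ H) : Model H →L[ℝ] Model H →L[ℝ] ℝ :=
  (LinearMap.mk₂ ℝ (fun u v : Model H => fsForm (unitRep p) (lift p u) (lift p v))
    (fun u u' v => by simp only [fsForm_lift, inner_add_left, Complex.add_re])
    (fun c u v => by
      rw [fsForm_lift, fsForm_lift, ← Complex.coe_smul c u, inner_smul_left, Complex.conj_ofReal,
        Complex.re_ofReal_mul, smul_eq_mul])
    (fun u v v' => by simp only [fsForm_lift, inner_add_right, Complex.add_re])
    (fun c u v => by
      rw [fsForm_lift, fsForm_lift, ← Complex.coe_smul c v, inner_smul_right,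
        Complex.re_ofReal_mul, smul_eq_mul])).toContinuousBilinearMap

theorem fsTensor_apply (p : ℙ ℂ H) (u v : Model H) :
    fsTensor p u v = fsForm (unitRep p) (lift p u) (lift p v) := rfl

theorem hasFDerivAt_coord (p : ℙ ℂ H) (χ : H) (hχ : χ ≠ 0) (h : Projectivization.mk ℂ χ hχ = p) :
    HasFDerivAt (coord p) (((⟪unitRep p, χ⟫_ℂ)⁻¹ • colift p).restrictScalars ℝ) χ := by
  obtain ⟨a, rfl⟩ : ∃ a : ℂ, a • unitRep p = χ := by
    rw [← Projectivization.mk_eq_mk_iff' ℂ _ _ hχ (unitRep_ne_zero p), mk_unitRep, h]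
  have ha : a ≠ 0 := fun h => hχ (by rw [h, zero_smul])
  have hA : colift p (a • unitRep p) = 0 := by rw [map_smul, colift_unitRep, smul_zero]
  have hl : innerSL ℂ (unitRep p) (a • unitRep p) ≠ 0 := by
    rwa [innerSL_apply_apply, inner_smul_right, inner_unitRep_self, mul_one]
  have h0 : HasFDerivAt (fun x => (innerSL ℂ (unitRep p) x)⁻¹) _ (a • unitRep p) :=
    (hasFDerivAt_inv' hl).comp _ (innerSL ℂ (unitRep p)).hasFDerivAt
  have h1 := h0.smul (colift p).hasFDerivAt
  refine HasFDerivAt.restrictScalars ℝ (h1.congr_fderiv ?_)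
  ext1 ξ
  simp [hA]

theorem fsForm_eq_of_mk (p : ℙ ℂ H) (χ : H) (hχ : χ ≠ 0) (h : Projectivization.mk ℂ χ hχ = p)
    (ξ η : H) :
    fsTensor p ((⟪unitRep p, χ⟫_ℂ)⁻¹ • colift p ξ) ((⟪unitRep p, χ⟫_ℂ)⁻¹ • colift p η) =
      (‖χ‖ ^ 2)⁻¹ * (⟪ξ, η⟫_ℂ - (‖χ‖ ^ 2 : ℝ)⁻¹ * (⟪ξ, χ⟫_ℂ * ⟪χ, η⟫_ℂ)).re := by
  obtain ⟨a, rfl⟩ : ∃ a : ℂ, a • unitRep p = χ := by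
    rw [← Projectivization.mk_eq_mk_iff' ℂ _ _ hχ (unitRep_ne_zero p), mk_unitRep, h]
  have ha : a ≠ 0 := fun h => hχ (by rw [h, zero_smul])
  have hn : (‖a‖ : ℂ) ≠ 0 := by simpa using ha
  rw [fsTensor_apply, fsForm_lift, norm_smul, norm_unitRep, mul_one, inner_smul_left,
    inner_smul_right, inner_smul_right, inner_unitRep_self, mul_one, ← mul_assoc]
  have h1 : (starRingEnd ℂ) a⁻¹ * a⁻¹ = ((‖a‖ ^ 2)⁻¹ : ℝ) := by
    rw [map_inv₀, ← mul_inv, mul_comm, Complex.mul_conj, Complex.normSq_eq_norm_sq]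
    push_cast; rfl
  have h2 : ((‖a‖ ^ 2 : ℝ) : ℂ) = a * (starRingEnd ℂ) a := by
    rw [Complex.mul_conj, Complex.normSq_eq_norm_sq]
  rw [h1, Complex.re_ofReal_mul, fsForm_colift, fsForm]
  congr 3
  rw [inner_smul_right, inner_smul_left, Complex.ofReal_inv, h2]
  have : (starRingEnd ℂ) a ≠ 0 := by simpa using ha
  field_simp

/-- Coordinate expression of the Fubini-Study tensor in the affine chart at `p`. -/
theorem fsTensor_tangentCoordChange (p q : ℙ ℂ H) (hq : q ∈ (affineChart p).source)
    (u v : Model H) :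
    fsTensor q (tangentCoordChange 𝓘(ℝ, Model H) p q q u)
        (tangentCoordChange 𝓘(ℝ, Model H) p q q v) =
      (‖unitRep p + lift p (affineChart p q)‖ ^ 2)⁻¹ * (⟪lift p u, lift p v⟫_ℂ -
        (‖unitRep p + lift p (affineChart p q)‖ ^ 2 : ℝ)⁻¹ *
          (⟪lift p u, unitRep p + lift p (affineChart p q)⟫_ℂ *
            ⟪unitRep p + lift p (affineChart p q), lift p v⟫_ℂ)).re := by
  set z := affineChart p q with hz
  have hm : Projectivization.mk ℂ _ (affine_ne_zero p z) = q := (affineChart p).left_inv hq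
  rw [← fsForm_eq_of_mk q _ (affine_ne_zero p z) hm]
  have h1 : tangentCoordChange 𝓘(ℝ, Model H) p q q =
      (((⟪unitRep q, unitRep p + lift p z⟫_ℂ)⁻¹ • colift q).restrictScalars ℝ) ∘L
        (lift p).restrictScalars ℝ := by
    rw [tangentCoordChange_def]
    simp only [modelWithCornersSelf_coe, Set.range_id, fderivWithin_univ]
    have h2 : (extChartAt 𝓘(ℝ, Model H) q ∘ (extChartAt 𝓘(ℝ, Model H) p).symm) =
        coord q ∘ fun z => unitRep p + lift p z := by
      ext1 w
      exact coord_rep_mk q _ (affine_ne_zero p w)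
    rw [h2]
    refine HasFDerivAt.fderiv ?_
    change HasFDerivAt _ _ z
    exact (hasFDerivAt_coord q _ (affine_ne_zero p z) hm).comp z
      (((lift p).restrictScalars ℝ).hasFDerivAt.const_add _)
  rw [h1]
  rfl

variable (H) in
/-- Smooth Riemannian metrics on the projective space of `H`. -/
abbrev RiemannianMetric : Type _ :=
  Bundle.ContMDiffRiemannianMetric 𝓘(ℝ, Model H) ∞ (Model H)
    (fun p : ℙ ℂ H => TangentSpace 𝓘(ℝ, Model H) p)

theorem contMDiff_fsTensor :
    ContMDiff 𝓘(ℝ, Model H) (𝓘(ℝ, Model H).prod 𝓘(ℝ, Model H →L[ℝ] Model H →L[ℝ] ℝ)) ∞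
    (fun p : ℙ ℂ H => Bundle.TotalSpace.mk' (Model H →L[ℝ] Model H →L[ℝ] ℝ)
      (E := fun p : ℙ ℂ H => TangentSpace 𝓘(ℝ, Model H) p →L[ℝ]
        TangentSpace 𝓘(ℝ, Model H) p →L[ℝ] ℝ) p (fsTensor p)) := by
  intro p
  rw [contMDiffAt_hom_bundle]
  refine ⟨contMDiffAt_id, ?_⟩
  set F : ℙ ℂ H → (Model H →L[ℝ] Model H →L[ℝ] ℝ) := fun q =>
    ContinuousLinearMap.inCoordinates (Model H) (fun p : ℙ ℂ H => TangentSpace 𝓘(ℝ, Model H) p)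
      (Model H →L[ℝ] ℝ) (fun p : ℙ ℂ H => TangentSpace 𝓘(ℝ, Model H) p →L[ℝ] ℝ)
      p q p q (fsTensor q) with hF
  change ContMDiffAt 𝓘(ℝ, Model H) 𝓘(ℝ, Model H →L[ℝ] Model H →L[ℝ] ℝ) ∞ F p
  have key : ∀ q ∈ (affineChart p).source, ∀ u v : Model H, F q u v =
      fsTensor q (tangentCoordChange 𝓘(ℝ, Model H) p q q u)
        (tangentCoordChange 𝓘(ℝ, Model H) p q q v) := by
    intro q hq u v
    have h1 := inCoordinates_apply_eq₂ (𝕜 := ℝ)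
      (F₁ := Model H) (E₁ := fun p : ℙ ℂ H => TangentSpace 𝓘(ℝ, Model H) p)
      (F₂ := Model H) (E₂ := fun p : ℙ ℂ H => TangentSpace 𝓘(ℝ, Model H) p)
      (F₃ := ℝ) (E₃ := Bundle.Trivial (ℙ ℂ H) ℝ)
      (x₀ := p) (x := q) (ϕ := fsTensor q) (v := u) (w := v) hq hq (Set.mem_univ _)
    have h2 := TangentBundle.symmL_trivializationAt_eq_core (I := 𝓘(ℝ, Model H))
      (b₀ := p) (b := q) hq
    have h3 : ∀ w : Model H, (trivializationAt (Model H)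
        (fun p : ℙ ℂ H => TangentSpace 𝓘(ℝ, Model H) p) p).symm q w =
          tangentCoordChange 𝓘(ℝ, Model H) p q q w := fun w => by
      rw [tangentCoordChange, ← h2]
      exact (Bundle.Trivialization.symmL_apply _ hq w).symm
    refine h1.trans ?_
    rw [h3, h3]
    simp
    rfl
  have hG : ContDiff ℝ ∞ (F ∘ (affineChart p).symm) := by
    rw [contDiff_clm_apply_iff]
    intro u
    rw [contDiff_clm_apply_iff]
    intro v
    have h1 : (fun z => (F ∘ (affineChart p).symm) z u v) = fun z =>
        (‖unitRep p + lift p z‖ ^ 2)⁻¹ * (⟪lift p u, lift p v⟫_ℂ -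
          (‖unitRep p + lift p z‖ ^ 2 : ℝ)⁻¹ *
          (⟪lift p u, unitRep p + lift p z⟫_ℂ * ⟪unitRep p + lift p z, lift p v⟫_ℂ)).re := by
      ext1 z
      have hz : (affineChart p).symm z ∈ (affineChart p).source :=
        (affineChart p).map_target (Set.mem_univ z)
      rw [Function.comp_apply, key _ hz, fsTensor_tangentCoordChange p _ hz,
        (affineChart p).right_inv (Set.mem_univ z)]
    rw [h1]
    have hχ : ContDiff ℝ ∞ fun z => unitRep p + lift p z :=
      contDiff_const.add ((lift p).restrictScalars ℝ).contDiff
    have hs : ContDiff ℝ ∞ fun z => (‖unitRep p + lift p z‖ ^ 2)⁻¹ :=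
      (hχ.norm_sq ℂ).inv fun z => pow_ne_zero 2 (norm_ne_zero_iff.2 (affine_ne_zero p z))
    refine hs.mul (Complex.reCLM.contDiff.comp (contDiff_const.sub ?_))
    exact (Complex.ofRealCLM.contDiff.comp hs).mul
      ((contDiff_const.inner ℂ hχ).mul (hχ.inner ℂ contDiff_const))
  have hc : ContMDiffAt 𝓘(ℝ, Model H) 𝓘(ℝ, Model H) ∞ (affineChart p) p :=
    contMDiffAt_extChartAt (I := 𝓘(ℝ, Model H)) (x := p)
  refine (hG.contMDiff.contMDiffAt.comp p hc).congr_of_eventuallyEq ?_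
  filter_upwards [(affineChart p).open_source.mem_nhds (mem_chart_source (Model H) p)] with q hq
  simp only [Function.comp_apply, (affineChart p).left_inv hq]

theorem fsTensor_symm (p : ℙ ℂ H) (u v : Model H) : fsTensor p u v = fsTensor p v u := by
  rw [fsTensor_apply, fsForm_lift, fsTensor_apply, fsForm_lift, ← inner_conj_symm, Complex.conj_re]

theorem fsTensor_self (p : ℙ ℂ H) (u : Model H) : fsTensor p u u = ‖u‖ ^ 2 := by
  rw [fsTensor_apply, fsForm_lift, inner_self_eq_norm_sq_to_K]
  norm_cast

theorem isBounded_fsTensor_lt_one (p : ℙ ℂ H) :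
    Bornology.IsBounded {u : Model H | fsTensor p u u < 1} := by
  refine (Metric.isBounded_ball (x := 0) (r := 1)).subset fun u hu => ?_
  have hu' : fsTensor p u u < 1 := hu
  rw [fsTensor_self] at hu'
  rw [Metric.mem_ball, dist_zero_right]
  exact (sq_lt_one_iff₀ (norm_nonneg _)).1 hu'

/-- The Fubini-Study metric on the projective space of `H`. -/
def fubiniStudy : RiemannianMetric H where
  inner p := fsTensor p
  symm p u v := fsTensor_symm p u v
  pos p u hu := (pow_pos (norm_pos_iff.2 hu) 2).trans_eq (fsTensor_self p u).symm
  isVonNBounded p := NormedSpace.isVonNBounded_of_isBounded ℝ (isBounded_fsTensor_lt_one p)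
  contMDiff := contMDiff_fsTensor

/-- The space of nonzero vectors, as an open submanifold of `H`. -/
def nonzero (H : Type*) [NormedAddCommGroup H] : TopologicalSpace.Opens H :=
  ⟨{0}ᶜ, isOpen_compl_singleton⟩

/-- The canonical projection `ψ ↦ [ψ]`. -/
def proj (ψ : nonzero H) : ℙ ℂ H := Projectivization.mk ℂ ψ.1 ψ.2

theorem hasMFDerivAt_proj (ψ : nonzero H) :
    HasMFDerivAt 𝓘(ℝ, H) 𝓘(ℝ, Model H) (proj : nonzero H → ℙ ℂ H) ψ
      (((⟪unitRep (proj ψ), ψ.1⟫_ℂ)⁻¹ • colift (proj ψ)).restrictScalars ℝ) := by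
  refine ⟨isQuotientMap_mk'.continuous.continuousAt, ?_⟩
  have h1 : extChartAt 𝓘(ℝ, H) ψ ψ = ψ.1 := rfl
  rw [h1]
  refine HasFDerivAt.hasFDerivWithinAt ?_
  refine (hasFDerivAt_coord (proj ψ) ψ.1 ψ.2 rfl).congr_of_eventuallyEq ?_
  filter_upwards [(nonzero H).isOpen.mem_nhds ψ.2] with χ hχ
  have h2 : (extChartAt 𝓘(ℝ, H) ψ).symm χ = ⟨χ, hχ⟩ := by
    have h3 := (extChartAt 𝓘(ℝ, H) ψ).left_inv (x := ⟨χ, hχ⟩) (by simp [chartAt_self_eq, TopologicalSpace.Opens.chartAt_eq])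
    exact h3
  simp only [writtenInExtChartAt, Function.comp_apply, h2]
  exact coord_rep_mk _ χ hχ

/-- The Fubini-Study metric at `[ψ]`, for any unit vector `ψ`, is the form `fsForm ψ` on the
velocities `ξ`, `η` of lifts to `H ∖ {0}`. -/
theorem fubiniStudy_mfderiv_proj (ψ : nonzero H) (hψ : ‖ψ.1‖ = 1) (ξ η : H) :
    fubiniStudy.inner (proj ψ) (mfderiv 𝓘(ℝ, H) 𝓘(ℝ, Model H) (proj : nonzero H → ℙ ℂ H) ψ ξ)
      (mfderiv 𝓘(ℝ, H) 𝓘(ℝ, Model H) (proj : nonzero H → ℙ ℂ H) ψ η) = fsForm ψ.1 ξ η := by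
  rw [(hasMFDerivAt_proj ψ).mfderiv]
  refine (fsForm_eq_of_mk (proj ψ) ψ.1 ψ.2 rfl ξ η).trans ?_
  simp [hψ, fsForm]

/-- The action of a unitary operator on the projective space, `[ψ] ↦ [U ψ]`. -/
def unitaryAct (U : H ≃ₗᵢ[ℂ] H) : ℙ ℂ H → ℙ ℂ H :=
  Projectivization.map (U.toLinearEquiv : H →ₗ[ℂ] H) U.injective

/-- Invariance under the unitary group: every unitary operator acts by isometries of `g`. -/
def UnitarilyInvariant (g : RiemannianMetric H) : Prop :=
  ∀ (U : H ≃ₗᵢ[ℂ] H) (p : ℙ ℂ H) (u v : TangentSpace 𝓘(ℝ, Model H) p),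
    g.inner (unitaryAct U p)
        (mfderiv 𝓘(ℝ, Model H) 𝓘(ℝ, Model H) (unitaryAct U) p u)
        (mfderiv 𝓘(ℝ, Model H) 𝓘(ℝ, Model H) (unitaryAct U) p v) =
      g.inner p u v

end ProjectiveHilbert

end

namespace ProjectiveHilbert

variable {H : Type*} [NormedAddCommGroup H] [InnerProductSpace ℂ H]

/-! The unitary group acts transitively on the set of pairs (point, Fubini-Study unit tangent
vector), so no representation theory is needed. In the affine chart centred at a point, the
Fubini-Study norm is the norm of the model space (`fsTensor_self`). A unitary of the model space
carrying `u` to `v`, completed by sending a unit vector on the line `p` to one on the line `q`,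
gives a unitary of `H` whose action carries `(p, u)` to `(q, v)` (`exists_unitaryAct_mfderiv_eq`).
An invariant metric `g` is therefore constant, say `c`, on all such unit vectors; homogeneity and
polarization then give `g = c • g_FS` on all pairs of tangent vectors.

Invariance of the Fubini-Study metric itself follows from `fsForm_eq_of_mk`, which computes it from
an arbitrary representative of the line using only inner products and norms, all of which a unitary
preserves. -/

/-! ### Transitivity on unit vectors -/

/-- The unitary group acts transitively on the unit sphere. -/
theorem exists_linearIsometryEquiv_apply_eq {E : Type*} [NormedAddCommGroup E]
    [InnerProductSpace ℂ E] [FiniteDimensional ℂ E] {u v : E} (hu : ‖u‖ = 1) (hv : ‖v‖ = 1) :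
    ∃ W : E ≃ₗᵢ[ℂ] E, W u = v := by
  have : Nontrivial E := ⟨u, 0, norm_ne_zero_iff.1 (by simp [hu])⟩
  let i : Fin (finrank ℂ E) := ⟨0, finrank_pos⟩
  have key : ∀ w : E, ‖w‖ = 1 → ∃ b : OrthonormalBasis (Fin (finrank ℂ E)) ℂ E, b i = w := by
    intro w hw
    -- The vector `w` is regarded as an orthonormal family indexed by `{i}`, so that both bases
    -- below have their prescribed vector at the same index `i`.
    have ho : Orthonormal ℂ (({i} : Set (Fin (finrank ℂ E))).domRestrict fun _ => w) := by
      refine ⟨fun _ => hw, fun j k hjk => (hjk (Subsingleton.elim j k)).elim⟩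
    obtain ⟨b, hb⟩ := ho.exists_orthonormalBasis_extension_of_card_eq (by simp)
    exact ⟨b, hb i rfl⟩
  obtain ⟨b, hb⟩ := key u hu
  obtain ⟨b', hb'⟩ := key v hv
  refine ⟨b.repr.trans b'.repr.symm, ?_⟩
  rw [← hb, ← hb', LinearIsometryEquiv.trans_apply, b.repr_self, b'.repr_symm_single]

/-! ### The action on lines and its lifts to `H` -/

theorem unitaryAct_mk (U : H ≃ₗᵢ[ℂ] H) (χ : H) (hχ : χ ≠ 0) :
    unitaryAct U (Projectivization.mk ℂ χ hχ) =
      Projectivization.mk ℂ (U χ) ((map_ne_zero_iff U U.injective).2 hχ) := rfl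

theorem map_unitRep_ne_zero (U : H ≃ₗᵢ[ℂ] H) (p : ℙ ℂ H) : U (unitRep p) ≠ 0 :=
  (map_ne_zero_iff U U.injective).2 (unitRep_ne_zero p)

theorem mk_map_unitRep (U : H ≃ₗᵢ[ℂ] H) (p : ℙ ℂ H) :
    Projectivization.mk ℂ (U (unitRep p)) (map_unitRep_ne_zero U p) = unitaryAct U p := by
  rw [← unitaryAct_mk U _ (unitRep_ne_zero p), mk_unitRep]

theorem continuous_unitaryAct (U : H ≃ₗᵢ[ℂ] H) : Continuous (unitaryAct U) := by
  rw [isQuotientMap_mk'.continuous_iff]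
  exact isQuotientMap_mk'.continuous.comp (Continuous.subtype_mk (U.continuous.comp
    continuous_subtype_val) fun v => (map_ne_zero_iff U U.injective).2 v.2)

variable [FiniteDimensional ℂ H]

/-- Pythagoras for the splitting `decomp`, since `lift p` is isometric. -/
theorem norm_sq_eq_unitRep_colift (p : ℙ ℂ H) (χ : H) :
    ‖χ‖ ^ 2 = ‖⟪unitRep p, χ⟫_ℂ‖ ^ 2 + ‖colift p χ‖ ^ 2 := by
  have hl : ‖lift p (colift p χ)‖ = ‖colift p χ‖ := by
    rw [@norm_eq_sqrt_re_inner ℂ, @norm_eq_sqrt_re_inner ℂ, inner_lift_lift]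
  have h := norm_add_sq_eq_norm_sq_add_norm_sq_of_inner_eq_zero (𝕜 := ℂ)
    (⟪unitRep p, χ⟫_ℂ • unitRep p) (lift p (colift p χ))
    (by rw [inner_smul_left, inner_unitRep_lift, mul_zero])
  rw [decomp, norm_smul, norm_unitRep, mul_one, hl] at h
  simpa only [sq] using h

/-- A unitary operator of the model space extends to a unitary operator of `H` carrying the affine
chart at `p` to the affine chart at `q`. -/
theorem exists_unitary_affine (p q : ℙ ℂ H) (W : Model H ≃ₗᵢ[ℂ] Model H) :
    ∃ U : H ≃ₗᵢ[ℂ] H, U (unitRep p) = unitRep q ∧ ∀ z, U (lift p z) = lift q (W z) := by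
  -- Block form: the line `p` goes to the line `q`, and `W` acts between the orthogonal complements,
  -- both identified with the model space.
  let L : H →ₗ[ℂ] H := ((innerSL ℂ (unitRep p)).smulRight (unitRep q) +
    lift q ∘L (W : Model H →L[ℂ] Model H) ∘L colift p : H →L[ℂ] H)
  have hL : ∀ χ, L χ = ⟪unitRep p, χ⟫_ℂ • unitRep q + lift q (W (colift p χ)) := fun _ => rfl
  have hn : ∀ χ, ‖L χ‖ = ‖χ‖ := by
    intro χ
    rw [← sq_eq_sq₀ (norm_nonneg _) (norm_nonneg _), norm_sq_eq_unitRep_colift p χ,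
      norm_sq_eq_unitRep_colift q, hL, inner_add_right, inner_smul_right, inner_unitRep_self,
      inner_unitRep_lift, map_add, map_smul, colift_unitRep, colift_lift]
    simp
  -- An isometry from a finite-dimensional space to itself is onto.
  refine ⟨LinearIsometry.toLinearIsometryEquiv ⟨L, hn⟩ rfl, ?_, fun z => ?_⟩
  · change L _ = _
    rw [hL, inner_unitRep_self, colift_unitRep]
    simp
  · change L _ = _
    rw [hL, inner_unitRep_lift, colift_lift]
    simp

/-! ### The derivative of the action -/

theorem affineChart_self (p : ℙ ℂ H) : affineChart p p = 0 := by
  change coord p p.rep = 0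
  have h := coord_rep_mk p (unitRep p) (unitRep_ne_zero p)
  rw [mk_unitRep] at h
  rw [h, coord, colift_unitRep, smul_zero]

/-- In the charts centred at `p` and at its image, the action is `coord` after an affine map. The
chosen unit vector on the image line agrees with `U (unitRep p)` only up to a phase; the inverse
inner product corrects for it. -/
theorem hasMFDerivAt_unitaryAct (U : H ≃ₗᵢ[ℂ] H) (p : ℙ ℂ H) :
    HasMFDerivAt 𝓘(ℝ, Model H) 𝓘(ℝ, Model H) (unitaryAct U) p
      (((⟪unitRep (unitaryAct U p), U (unitRep p)⟫_ℂ)⁻¹ •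
        (colift (unitaryAct U p) ∘L (U : H →L[ℂ] H) ∘L lift p)).restrictScalars ℝ :
          Model H →L[ℝ] Model H) := by
  refine ⟨(continuous_unitaryAct U).continuousAt, HasFDerivAt.hasFDerivWithinAt ?_⟩
  have h0 : extChartAt 𝓘(ℝ, Model H) p p = 0 := affineChart_self p
  have h1 : writtenInExtChartAt 𝓘(ℝ, Model H) 𝓘(ℝ, Model H) p (unitaryAct U) =
      coord (unitaryAct U p) ∘ fun z => U (unitRep p) + U (lift p z) := by
    ext1 z
    refine (coord_rep_mk (unitaryAct U p) (U (unitRep p + lift p z))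
      ((map_ne_zero_iff U U.injective).2 (affine_ne_zero p z))).trans ?_
    rw [map_add]; rfl
  rw [h0, h1]
  have h2 : HasFDerivAt (fun z => U (unitRep p) + U (lift p z))
      (((U : H →L[ℂ] H) ∘L lift p).restrictScalars ℝ) (0 : Model H) :=
    (((U : H →L[ℂ] H) ∘L lift p).restrictScalars ℝ).hasFDerivAt.const_add _
  have h3 := hasFDerivAt_coord (unitaryAct U p) _ (map_unitRep_ne_zero U p) (mk_map_unitRep U p)
  have h4 : U (unitRep p) + U (lift p 0) = U (unitRep p) := by simp
  rw [← h4] at h3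
  refine (h3.comp (0 : Model H) h2).congr_fderiv ?_
  rw [h4]
  rfl

theorem mfderiv_unitaryAct_apply (U : H ≃ₗᵢ[ℂ] H) (p : ℙ ℂ H) (u : Model H) :
    mfderiv 𝓘(ℝ, Model H) 𝓘(ℝ, Model H) (unitaryAct U) p u =
      ((⟪unitRep (unitaryAct U p), U (unitRep p)⟫_ℂ)⁻¹ •
        colift (unitaryAct U p) (U (lift p u)) : Model H) := by
  rw [(hasMFDerivAt_unitaryAct U p).mfderiv]
  rfl

/-! ### Invariance, and uniqueness up to scale -/

/-- The vector `U (unitRep p)` is a legitimate representative of the image line, so the phase in the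
derivative is absorbed by `fsForm_eq_of_mk`; what remains involves only inner products of images
under `U`. -/
theorem unitarilyInvariant_fubiniStudy : UnitarilyInvariant (fubiniStudy (H := H)) := by
  intro U p u v
  erw [mfderiv_unitaryAct_apply, mfderiv_unitaryAct_apply]
  refine (fsForm_eq_of_mk (unitaryAct U p) _ (map_unitRep_ne_zero U p) (mk_map_unitRep U p)
    (U (lift p u)) (U (lift p v))).trans ?_
  change _ = fsForm (unitRep p) (lift p u) (lift p v)
  simp only [LinearIsometryEquiv.norm_map, LinearIsometryEquiv.inner_map_map, norm_unitRep, fsForm]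
  simp

/-- The unitary group acts transitively on the tangent vectors of Fubini-Study length one. -/
theorem exists_unitaryAct_mfderiv_eq (p q : ℙ ℂ H) {u v : Model H} (hu : ‖u‖ = 1) (hv : ‖v‖ = 1) :
    ∃ U : H ≃ₗᵢ[ℂ] H, unitaryAct U p = q ∧
      mfderiv 𝓘(ℝ, Model H) 𝓘(ℝ, Model H) (unitaryAct U) p u = (v : Model H) := by
  obtain ⟨W, hW⟩ := exists_linearIsometryEquiv_apply_eq hu hv
  obtain ⟨U, hU, hU'⟩ := exists_unitary_affine p q W
  have h : unitaryAct U p = q := by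
    rw [← mk_map_unitRep]
    simp only [hU, mk_unitRep]
  refine ⟨U, h, ?_⟩
  -- Here `U` matches the chosen unit vectors exactly, so the phase is 1 and the derivative is `W`
  -- itself.
  rw [mfderiv_unitaryAct_apply, h, hU, hU', hW, inner_unitRep_self, colift_lift, inv_one, one_smul]

theorem UnitarilyInvariant.inner_self_eq {g : RiemannianMetric H} (hg : UnitarilyInvariant g)
    (p q : ℙ ℂ H) {u v : Model H} (hu : ‖u‖ = 1) (hv : ‖v‖ = 1) :
    g.inner p u u = g.inner q v v := by
  obtain ⟨U, rfl, h⟩ := exists_unitaryAct_mfderiv_eq p q hu hv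
  rw [← hg U p u u]
  exact congrArg (fun w : Model H => g.inner (unitaryAct U p) w w) h

/-- Symmetric bilinear forms with the same quadratic form on unit vectors, up to a factor, agree
up to that factor. -/
theorem bilin_eq_of_unit_sphere {E : Type*} [NormedAddCommGroup E] [NormedSpace ℝ E]
    {B B' : E →L[ℝ] E →L[ℝ] ℝ} (hB : ∀ u v, B u v = B v u) (hB' : ∀ u v, B' u v = B' v u) {c : ℝ}
    (h : ∀ u, ‖u‖ = 1 → B u u = c * B' u u) (u v : E) : B u v = c * B' u v := by
  have hq : ∀ w, B w w = c * B' w w := by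
    intro w
    rcases eq_or_ne w 0 with rfl | hw
    · simp
    have hn : ‖w‖ ≠ 0 := norm_ne_zero_iff.2 hw
    -- Both quadratic forms are homogeneous of degree two, so normalizing `w` suffices.
    have h1 := h (‖w‖⁻¹ • w) (by rw [norm_smul, norm_inv, norm_norm, inv_mul_cancel₀ hn])
    simp only [map_smul, smul_apply, smul_eq_mul] at h1
    field_simp at h1
    exact h1
  -- Polarization: by symmetry the cross terms on each side combine into twice the bilinear form.
  have h1 := hq (u + v)
  simp only [map_add, add_apply, hB v u, hB' v u] at h1
  linarith [hq u, hq v]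

theorem UnitarilyInvariant.exists_eq_mul_fubiniStudy {g : RiemannianMetric H}
    (hg : UnitarilyInvariant g) :
    ∃ c : ℝ, 0 < c ∧ ∀ (p : ℙ ℂ H) (u v : TangentSpace 𝓘(ℝ, Model H) p),
      g.inner p u v = c * fubiniStudy.inner p u v := by
  have key : ∀ c : ℝ, (∀ (p : ℙ ℂ H) (u : Model H), ‖u‖ = 1 → g.inner p u u = c) →
      ∀ (p : ℙ ℂ H) (u v : TangentSpace 𝓘(ℝ, Model H) p),
        g.inner p u v = c * fubiniStudy.inner p u v := fun c h p u v =>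
    bilin_eq_of_unit_sphere (E := Model H) (B := g.inner p) (B' := fsTensor p) (g.symm p)
      (fsTensor_symm p) (fun w hw => by rw [fsTensor_self, hw, one_pow, mul_one]; exact h p w hw)
      u v
  -- If there is no point or every tangent space is zero (`d ≤ 1`), no unit tangent vector exists to
  -- define `c`; any positive constant works, and 1 is taken.
  by_cases hne : ∃ (_ : ℙ ℂ H) (u : Model H), ‖u‖ = 1
  · obtain ⟨p, u, hu⟩ := hne
    have hu0 : u ≠ 0 := norm_ne_zero_iff.1 (by simp [hu])
    exact ⟨g.inner p u u, g.pos p u hu0, key _ fun q v hv => hg.inner_self_eq q p hv hu⟩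
  · exact ⟨1, one_pos, key _ fun q v hv => (hne ⟨q, v, hv⟩).elim⟩

end ProjectiveHilbert

theorem mainTheorem2 {H : Type*} [NormedAddCommGroup H] [InnerProductSpace ℂ H]
    [FiniteDimensional ℂ H] :
    ProjectiveHilbert.UnitarilyInvariant (ProjectiveHilbert.fubiniStudy (H := H)) ∧
    ∀ g : ProjectiveHilbert.RiemannianMetric H, ProjectiveHilbert.UnitarilyInvariant g →
      ∃ c : ℝ, 0 < c ∧ ∀ (p : ℙ ℂ H) (u v : TangentSpace 𝓘(ℝ, ProjectiveHilbert.Model H) p),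
        g.inner p u v = c * ProjectiveHilbert.fubiniStudy.inner p u v :=
  ⟨ProjectiveHilbert.unitarilyInvariant_fubiniStudy, fun _ hg => hg.exists_eq_mul_fubiniStudy⟩
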